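/- Let formulae be built from a set of propositional letters and the constants $\bot,\top$ by the binary connectives $\wedge,\vee,\cdot,\to,\leftarrow$. Formula structures are built from formulae by the binary structural operations $\odot$ and $\barwedge$ (there is no empty structure), and $\Gamma[\Delta]$ denotes a formula structure with a distinguished occurrence of a substructure $\Delta$, which may be the whole structure. Sequents have the form $\Gamma\Rightarrow A$ with $\Gamma$ a formula structure and $A$ a formula. The sequent calculus $\mathsf{L_{RBL}}$ has the axioms $$A\Rightarrow A,\qquad A\Rightarrow\top,\qquad \bot\Rightarrow A$$ and the following rules (premises before the slash, conclusion after it): - $(\to\mathrm L)$ $\ \Delta\Rightarrow A,\ \Gamma[B]\Rightarrow C\ /\ \Gamma[\Delta\odot(A\to B)]\Rightarrow C$; $\quad(\to\mathrm R)$ $\ A\odot\Gamma\Rightarrow B\ /\ \Gamma\Rightarrow A\to B$; - $(\leftarrow\mathrm L)$ $\ \Gamma[A]\Rightarrow C,\ \Delta\Rightarrow B\ /\ \Gamma[(A\leftarrow B)\odot\Delta]\Rightarrow C$; $\quad(\leftarrow\mathrm R)$ $\ \Gamma\odot B\Rightarrow A\ /\ \Gamma\Rightarrow A\leftarrow B$;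 - $(\cdot\,\mathrm L)$ $\ \Gamma[A\odot B]\Rightarrow C\ /\ \Gamma[A\cdot B]\Rightarrow C$; $\quad(\cdot\,\mathrm R)$ $\ \Gamma\Rightarrow A,\ \Delta\Rightarrow B\ /\ \Gamma\odot\Delta\Rightarrow A\cdot B$; - $(\wedge\mathrm L)$ $\ \Gamma[A\barwedge B]\Rightarrow C\ /\ \Gamma[A\wedge B]\Rightarrow C$; $\quad(\wedge\mathrm R)$ $\ \Gamma\Rightarrow A,\ \Gamma\Rightarrow B\ /\ \Gamma\Rightarrow A\wedge B$; - $(\vee\mathrm L)$ $\ \Gamma[A]\Rightarrow C,\ \Gamma[B]\Rightarrow C\ /\ \Gamma[A\vee B]\Rightarrow C$; $\quad(\vee\mathrm R)$ $\ \Gamma\Rightarrow A_i\ /\ \Gamma\Rightarrow A_1\vee A_2$ for $i\in\{1,2\}$; - contraction: $\ \Gamma[\Delta\barwedge\Delta]\Rightarrow A\ /\ \Gamma[\Delta]\Rightarrow A$ and $\ \Gamma[(\Lambda\odot\Delta)\odot\Delta]\Rightarrow A\ /\ \Gamma[\Lambda\odot\Delta]\Rightarrow A$; - exchange: $\ \Gamma[\Delta\barwedge\Lambda]\Rightarrow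 A\ /\ \Gamma[\Lambda\barwedge\Delta]\Rightarrow A$; - weakening, for $*\in\{\barwedge,\odot\}$: $\ \Gamma[\Delta]\Rightarrow A\ /\ \Gamma[\Delta'*\Delta]\Rightarrow A$ and $\ \Gamma[\Delta]\Rightarrow A\ /\ \Gamma[\Delta*\Delta']\Rightarrow A$; - associativity: $\ \Gamma[(\Delta_1\barwedge\Delta_2)\barwedge\Delta_3]\Rightarrow A\ /\ \Gamma[\Delta_1\barwedge(\Delta_2\barwedge\Delta_3)]\Rightarrow A$, and its converse; - (Cut) $\ \Delta\Rightarrow A,\ \Gamma[A]\Rightarrow B\ /\ \Gamma[\Delta]\Rightarrow B$. **Corollary (Subformula Property).** If a sequent $\Gamma\Rightarrow A$ is derivable in $\mathsf{L_{RBL}}$, then it has a derivation in $\mathsf{L_{RBL}}$ such that every formula occurring in (a sequent of) the derivation is $\top$, or $\bot$, or a subformula of a formula occurring in $\Gamma$, or a subformula of $A$. -/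

import Mathlib

namespace RBL

universe u

/-- Formulae of the language of residuated basic logic over a set `α` of propositional letters. -/
inductive Formula (α : Type u) : Type u
  | var (p : α) : Formula α
  | bot : Formula α
  | top : Formula α
  | and (A B : Formula α) : Formula α
  | or (A B : Formula α) : Formula α
  /-- the product `A · B` -/
  | prod (A B : Formula α) : Formula α
  /-- the basic implication `A → B` (right residual of the product) -/
  | imp (A B : Formula α) : Formula α
  /-- the left residual `A ← B` of the product -/
  | limp (A B : Formula α) : Formula α

/-- The set of subformulae of a formula (the formula itself included). -/
def Formula.subformulas {α : Type u} : Formula α → Set (Formula α)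
  | .var p => {.var p}
  | .bot => {.bot}
  | .top => {.top}
  | .and A B => {.and A B} ∪ A.subformulas ∪ B.subformulas
  | .or A B => {.or A B} ∪ A.subformulas ∪ B.subformulas
  | .prod A B => {.prod A B} ∪ A.subformulas ∪ B.subformulas
  | .imp A B => {.imp A B} ∪ A.subformulas ∪ B.subformulas
  | .limp A B => {.limp A B} ∪ A.subformulas ∪ B.subformulas

/-- Formula structures: binary trees of formulae built with `⊙` and `⩕`. There is no empty
structure. -/
inductive Struct (α : Type u) : Type u
  /-- a formula, seen as a structure -/
  | fm (A : Formula α) : Struct α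
  /-- `Γ ⊙ Δ` -/
  | odot (Γ Δ : Struct α) : Struct α
  /-- `Γ ⩕ Δ` -/
  | owedge (Γ Δ : Struct α) : Struct α

/-- The formulae that a formula structure is built from. -/
def Struct.formulas {α : Type u} : Struct α → Set (Formula α)
  | .fm A => {A}
  | .odot Γ Δ => Γ.formulas ∪ Δ.formulas
  | .owedge Γ Δ => Γ.formulas ∪ Δ.formulas

/-- Contexts `Γ[-]`: formula structures with exactly one hole. -/
inductive Ctx (α : Type u) : Type u
  | hole : Ctx α
  | odotL (c : Ctx α) (Δ : Struct α) : Ctx α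
  | odotR (Δ : Struct α) (c : Ctx α) : Ctx α
  | owedgeL (c : Ctx α) (Δ : Struct α) : Ctx α
  | owedgeR (Δ : Struct α) (c : Ctx α) : Ctx α

/-- `c.fill Δ` is the structure `Γ[Δ]` obtained by putting `Δ` in the hole of `c = Γ[-]`. -/
def Ctx.fill {α : Type u} : Ctx α → Struct α → Struct α
  | .hole, Θ => Θ
  | .odotL c Δ, Θ => .odot (c.fill Θ) Δ
  | .odotR Δ c, Θ => .odot Δ (c.fill Θ)
  | .owedgeL c Δ, Θ => .owedge (c.fill Θ) Δ
  | .owedgeR Δ c, Θ => .owedge Δ (c.fill Θ)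

/-- Sequents `Γ ⇒ A`. -/
structure Sequent (α : Type u) : Type u where
  ant : Struct α
  suc : Formula α

/-- The formulae occurring in a sequent. -/
def Sequent.formulas {α : Type u} (s : Sequent α) : Set (Formula α) :=
  s.ant.formulas ∪ {s.suc}

/-- Derivation trees of the sequent calculus `L_RBL`; `Derivation Γ A` is the type of derivations
with end sequent `Γ ⇒ A`. -/
inductive Derivation {α : Type u} : Struct α → Formula α → Type u
  | id (A : Formula α) : Derivation (.fm A) A
  | top (A : Formula α) : Derivation (.fm A) .top
  | bot (A : Formula α) : Derivation (.fm .bot) A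
  | impL (c : Ctx α) (Δ : Struct α) (A B C : Formula α) :
      Derivation Δ A → Derivation (c.fill (.fm B)) C →
      Derivation (c.fill (.odot Δ (.fm (.imp A B)))) C
  | impR (Γ : Struct α) (A B : Formula α) :
      Derivation (.odot (.fm A) Γ) B → Derivation Γ (.imp A B)
  | limpL (c : Ctx α) (Δ : Struct α) (A B C : Formula α) :
      Derivation (c.fill (.fm A)) C → Derivation Δ B →
      Derivation (c.fill (.odot (.fm (.limp A B)) Δ)) C
  | limpR (Γ : Struct α) (A B : Formula α) :
      Derivation (.odot Γ (.fm B)) A → Derivation Γ (.limp A B)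
  | prodL (c : Ctx α) (A B C : Formula α) :
      Derivation (c.fill (.odot (.fm A) (.fm B))) C → Derivation (c.fill (.fm (.prod A B))) C
  | prodR (Γ Δ : Struct α) (A B : Formula α) :
      Derivation Γ A → Derivation Δ B → Derivation (.odot Γ Δ) (.prod A B)
  | andL (c : Ctx α) (A B C : Formula α) :
      Derivation (c.fill (.owedge (.fm A) (.fm B))) C → Derivation (c.fill (.fm (.and A B))) C
  | andR (Γ : Struct α) (A B : Formula α) :
      Derivation Γ A → Derivation Γ B → Derivation Γ (.and A B)
  | orL (c : Ctx α) (A B C : Formula α) :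
      Derivation (c.fill (.fm A)) C → Derivation (c.fill (.fm B)) C →
      Derivation (c.fill (.fm (.or A B))) C
  | orR₁ (Γ : Struct α) (A B : Formula α) : Derivation Γ A → Derivation Γ (.or A B)
  | orR₂ (Γ : Struct α) (A B : Formula α) : Derivation Γ B → Derivation Γ (.or A B)
  | owedgeC (c : Ctx α) (Δ : Struct α) (A : Formula α) :
      Derivation (c.fill (.owedge Δ Δ)) A → Derivation (c.fill Δ) A
  | odotC (c : Ctx α) (Λ Δ : Struct α) (A : Formula α) :
      Derivation (c.fill (.odot (.odot Λ Δ) Δ)) A → Derivation (c.fill (.odot Λ Δ)) A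
  | owedgeE (c : Ctx α) (Δ Λ : Struct α) (A : Formula α) :
      Derivation (c.fill (.owedge Δ Λ)) A → Derivation (c.fill (.owedge Λ Δ)) A
  | cut (c : Ctx α) (Δ : Struct α) (A B : Formula α) :
      Derivation Δ A → Derivation (c.fill (.fm A)) B → Derivation (c.fill Δ) B
  | owedgeW₁ (c : Ctx α) (Δ' Δ : Struct α) (A : Formula α) :
      Derivation (c.fill Δ) A → Derivation (c.fill (.owedge Δ' Δ)) A
  | odotW₁ (c : Ctx α) (Δ' Δ : Struct α) (A : Formula α) :
      Derivation (c.fill Δ) A → Derivation (c.fill (.odot Δ' Δ)) A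
  | owedgeW₂ (c : Ctx α) (Δ Δ' : Struct α) (A : Formula α) :
      Derivation (c.fill Δ) A → Derivation (c.fill (.owedge Δ Δ')) A
  | odotW₂ (c : Ctx α) (Δ Δ' : Struct α) (A : Formula α) :
      Derivation (c.fill Δ) A → Derivation (c.fill (.odot Δ Δ')) A
  | owedgeA₁ (c : Ctx α) (Δ₁ Δ₂ Δ₃ : Struct α) (A : Formula α) :
      Derivation (c.fill (.owedge (.owedge Δ₁ Δ₂) Δ₃)) A →
      Derivation (c.fill (.owedge Δ₁ (.owedge Δ₂ Δ₃))) A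
  | owedgeA₂ (c : Ctx α) (Δ₁ Δ₂ Δ₃ : Struct α) (A : Formula α) :
      Derivation (c.fill (.owedge Δ₁ (.owedge Δ₂ Δ₃))) A →
      Derivation (c.fill (.owedge (.owedge Δ₁ Δ₂) Δ₃)) A

/-- The set of formulae occurring in a derivation, i.e. in one of the sequents at its nodes: those
of the end sequent, and those of the derivations of the premises of the last rule. -/
def Derivation.formulas {α : Type u} {Γ : Struct α} {A : Formula α} (d : Derivation Γ A) :
    Set (Formula α) :=
  (Sequent.mk Γ A).formulas ∪
  match d with
  | .id _ | .top _ | .bot _ => ∅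
  | .impL _ _ _ _ _ d₁ d₂ | .limpL _ _ _ _ _ d₁ d₂ | .prodR _ _ _ _ d₁ d₂
  | .andR _ _ _ d₁ d₂ | .orL _ _ _ _ d₁ d₂ | .cut _ _ _ _ d₁ d₂ => d₁.formulas ∪ d₂.formulas
  | .impR _ _ _ d₁ | .limpR _ _ _ d₁ | .prodL _ _ _ _ d₁ | .andL _ _ _ _ d₁
  | .orR₁ _ _ _ d₁ | .orR₂ _ _ _ d₁ | .owedgeC _ _ _ d₁ | .odotC _ _ _ _ d₁
  | .owedgeE _ _ _ _ d₁ | .owedgeW₁ _ _ _ _ d₁ | .odotW₁ _ _ _ _ d₁ | .owedgeW₂ _ _ _ _ d₁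
  | .odotW₂ _ _ _ _ d₁ | .owedgeA₁ _ _ _ _ _ d₁ | .owedgeA₂ _ _ _ _ _ d₁ => d₁.formulas

/-- `Γ ⇒ A` is derivable in `L_RBL`. -/
def Derivable {α : Type u} (Γ : Struct α) (A : Formula α) : Prop :=
  Nonempty (Derivation Γ A)

end RBL

/-!
Cut elimination is proved semantically, in the style of Okada. Call a set of structures closed if
it is an intersection of sets of the form `{Δ | Γ[Δ] ⇒ C has a cut-free derivation}`. The
structural rules make the closed sets a residuated basic algebra, so the calculus, cut included, is
sound for the interpretation of formulae as closed sets in which a letter `p` denotes the set of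
structures that derive it without cut. The left rules give `A ∈ ⟦A⟧`, the right rules give that
every `Γ ∈ ⟦A⟧` derives `A` without cut. Hence a derivable `Γ ⇒ A`, for which
`Γ ∈ ⟦Γ⟧ ⊆ ⟦A⟧`, has a cut-free derivation, and the premises of every rule other than cut consist
of subformulae of its conclusion.
-/

namespace RBL

variable {α : Type*}

/-- Residuated basic algebras, the algebraic models of `L_RBL`: bounded distributive lattices with
a (neither associative nor commutative) residuated product that satisfies weakening and the
contraction law `a * b ≤ (a * b) * b`. The right residual `rres a c` interprets `a → c` and the
left residual `lres c b` interprets `c ← b`. -/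
class ResiduatedBasicAlgebra (L : Type*) extends DistribLattice L, BoundedOrder L, Mul L where
  rres : L → L → L
  lres : L → L → L
  mul_le_iff_le_rres (a b c : L) : a * b ≤ c ↔ b ≤ rres a c
  mul_le_iff_le_lres (a b c : L) : a * b ≤ c ↔ a ≤ lres c b
  mul_le_left (a b : L) : a * b ≤ a
  mul_le_right (a b : L) : a * b ≤ b
  mul_le_mul_mul_self (a b : L) : a * b ≤ a * b * b

namespace ResiduatedBasicAlgebra

variable {L : Type*} [ResiduatedBasicAlgebra L]

theorem gc_mul_rres (a : L) : GaloisConnection (a * ·) (rres a) :=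
  fun b c => mul_le_iff_le_rres a b c

theorem gc_mul_lres (b : L) : GaloisConnection (· * b) (lres · b) :=
  fun a c => mul_le_iff_le_lres a b c

instance : MulLeftMono L :=
  ⟨fun a _ _ h => (gc_mul_rres a).monotone_l h⟩

instance : MulRightMono L :=
  ⟨fun b _ _ h => (gc_mul_lres b).monotone_l h⟩

end ResiduatedBasicAlgebra

section Soundness

open ResiduatedBasicAlgebra

variable {L : Type*} [ResiduatedBasicAlgebra L] (v : α → L)

/-- The value of a formula in a residuated basic algebra under the valuation `v` of the letters. -/
def Formula.interp : Formula α → L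
  | .var p => v p
  | .bot => ⊥
  | .top => ⊤
  | .and A B => A.interp ⊓ B.interp
  | .or A B => A.interp ⊔ B.interp
  | .prod A B => A.interp * B.interp
  | .imp A B => rres A.interp B.interp
  | .limp A B => lres A.interp B.interp

/-- The value of a structure: `⊙` is read as the product and `⩕` as the meet. -/
def Struct.interp : Struct α → L
  | .fm A => A.interp v
  | .odot Γ Δ => Γ.interp * Δ.interp
  | .owedge Γ Δ => Γ.interp ⊓ Δ.interp

/-- The operation denoted by a context, as a function of the value put in its hole. -/
def Ctx.interp : Ctx α → L → L
  | .hole, x => x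
  | .odotL c Δ, x => c.interp x * Δ.interp v
  | .odotR Δ c, x => Δ.interp v * c.interp x
  | .owedgeL c Δ, x => c.interp x ⊓ Δ.interp v
  | .owedgeR Δ c, x => Δ.interp v ⊓ c.interp x

theorem Ctx.interp_fill (c : Ctx α) (Δ : Struct α) :
    (c.fill Δ).interp v = c.interp v (Δ.interp v) := by
  induction c <;> simp only [Ctx.fill, Ctx.interp, Struct.interp, *]

theorem Ctx.interp_sup (c : Ctx α) (x y : L) :
    c.interp v (x ⊔ y) = c.interp v x ⊔ c.interp v y := by
  induction c with
  | hole => rfl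
  | odotL c Δ ih => simpa only [Ctx.interp, ih] using (gc_mul_lres _).l_sup
  | odotR Δ c ih => simpa only [Ctx.interp, ih] using (gc_mul_rres _).l_sup
  | owedgeL c Δ ih => simp only [Ctx.interp, ih, inf_sup_right]
  | owedgeR Δ c ih => simp only [Ctx.interp, ih, inf_sup_left]

theorem Ctx.interp_mono (c : Ctx α) : Monotone (c.interp v) :=
  .of_map_sup (c.interp_sup v)

variable {v}

theorem Ctx.interp_fill_le_of_le (c : Ctx α) {Γ Δ : Struct α} {x : L}
    (h : Γ.interp v ≤ Δ.interp v) (hΔ : (c.fill Δ).interp v ≤ x) : (c.fill Γ).interp v ≤ x := by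
  rw [interp_fill] at hΔ ⊢
  exact (c.interp_mono v h).trans hΔ

variable (v)

theorem Derivation.interp_le {Γ : Struct α} {A : Formula α} (d : Derivation Γ A) :
    Γ.interp v ≤ A.interp v := by
  induction d with
  | id => exact le_rfl
  | top => exact le_top
  | bot => exact bot_le
  | impL c Δ A B C _ _ hΔ hC =>
    exact c.interp_fill_le_of_le (Δ := .fm B)
      ((mul_le_mul_left hΔ _).trans ((gc_mul_rres _).l_u_le _)) hC
  | impR Γ A B _ h => exact (mul_le_iff_le_rres _ _ _).1 h
  | limpL c Δ A B C _ _ hC hΔ =>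
    exact c.interp_fill_le_of_le (Δ := .fm A)
      ((mul_le_mul_right hΔ _).trans ((gc_mul_lres _).l_u_le _)) hC
  | limpR Γ A B _ h => exact (mul_le_iff_le_lres _ _ _).1 h
  | prodL c A B C _ h => exact c.interp_fill_le_of_le (Δ := .odot (.fm A) (.fm B)) le_rfl h
  | prodR Γ Δ A B _ _ hΓ hΔ => exact mul_le_mul' hΓ hΔ
  | andL c A B C _ h => exact c.interp_fill_le_of_le (Δ := .owedge (.fm A) (.fm B)) le_rfl h
  | andR Γ A B _ _ hA hB => exact le_inf hA hB
  | orL c A B C _ _ hA hB =>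
    rw [Ctx.interp_fill] at hA hB ⊢
    exact (c.interp_sup v _ _).trans_le (sup_le hA hB)
  | orR₁ Γ A B _ h => exact le_sup_of_le_left h
  | orR₂ Γ A B _ h => exact le_sup_of_le_right h
  | owedgeC c Δ A _ h => exact c.interp_fill_le_of_le (le_inf le_rfl le_rfl) h
  | odotC c Λ Δ A _ h => exact c.interp_fill_le_of_le (mul_le_mul_mul_self _ _) h
  | owedgeE c Δ Λ A _ h => exact c.interp_fill_le_of_le (inf_comm _ _).le h
  | cut c Δ A B _ _ hΔ hB => exact c.interp_fill_le_of_le (Δ := .fm A) hΔ hB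
  | owedgeW₁ c Δ' Δ A _ h => exact c.interp_fill_le_of_le inf_le_right h
  | odotW₁ c Δ' Δ A _ h => exact c.interp_fill_le_of_le (mul_le_right _ _) h
  | owedgeW₂ c Δ Δ' A _ h => exact c.interp_fill_le_of_le inf_le_left h
  | odotW₂ c Δ Δ' A _ h => exact c.interp_fill_le_of_le (mul_le_left _ _) h
  | owedgeA₁ c Δ₁ Δ₂ Δ₃ A _ h => exact c.interp_fill_le_of_le (inf_assoc _ _ _).ge h
  | owedgeA₂ c Δ₁ Δ₂ Δ₃ A _ h => exact c.interp_fill_le_of_le (inf_assoc _ _ _).le h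

end Soundness

/-- Derivations in which the cut rule is not applied. -/
def Derivation.IsCutFree {Γ : Struct α} {A : Formula α} : Derivation Γ A → Prop
  | .id _ | .top _ | .bot _ => True
  | .cut _ _ _ _ _ _ => False
  | .impL _ _ _ _ _ d₁ d₂ | .limpL _ _ _ _ _ d₁ d₂ | .prodR _ _ _ _ d₁ d₂
  | .andR _ _ _ d₁ d₂ | .orL _ _ _ _ d₁ d₂ => d₁.IsCutFree ∧ d₂.IsCutFree
  | .impR _ _ _ d₁ | .limpR _ _ _ d₁ | .prodL _ _ _ _ d₁ | .andL _ _ _ _ d₁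
  | .orR₁ _ _ _ d₁ | .orR₂ _ _ _ d₁ | .owedgeC _ _ _ d₁ | .odotC _ _ _ _ d₁
  | .owedgeE _ _ _ _ d₁ | .owedgeW₁ _ _ _ _ d₁ | .odotW₁ _ _ _ _ d₁ | .owedgeW₂ _ _ _ _ d₁
  | .odotW₂ _ _ _ _ d₁ | .owedgeA₁ _ _ _ _ _ d₁ | .owedgeA₂ _ _ _ _ _ d₁ => d₁.IsCutFree

/-- `Γ ⇒ A` has a cut-free derivation in `L_RBL`. -/
def CutFreeDerivable (Γ : Struct α) (A : Formula α) : Prop :=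
  ∃ d : Derivation Γ A, d.IsCutFree

theorem CutFreeDerivable.top_right (Γ : Struct α) : CutFreeDerivable Γ .top := by
  induction Γ with
  | fm A => exact ⟨.top A, trivial⟩
  | odot Γ Δ h _ => exact h.elim fun d hd => ⟨.odotW₂ .hole Γ Δ _ d, hd⟩
  | owedge Γ Δ h _ => exact h.elim fun d hd => ⟨.owedgeW₂ .hole Γ Δ _ d, hd⟩

theorem CutFreeDerivable.bot_left (c : Ctx α) (C : Formula α) :
    CutFreeDerivable (c.fill (.fm .bot)) C := by
  induction c with
  | hole => exact ⟨.bot C, trivial⟩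
  | odotL c Δ h => exact h.elim fun d hd => ⟨.odotW₂ .hole _ Δ C d, hd⟩
  | odotR Δ c h => exact h.elim fun d hd => ⟨.odotW₁ .hole Δ _ C d, hd⟩
  | owedgeL c Δ h => exact h.elim fun d hd => ⟨.owedgeW₂ .hole _ Δ C d, hd⟩
  | owedgeR Δ c h => exact h.elim fun d hd => ⟨.owedgeW₁ .hole Δ _ C d, hd⟩

/-- `c.comp e` is the context `c[e[-]]`. -/
def Ctx.comp : Ctx α → Ctx α → Ctx α
  | .hole, e => e
  | .odotL c Δ, e => .odotL (c.comp e) Δ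
  | .odotR Δ c, e => .odotR Δ (c.comp e)
  | .owedgeL c Δ, e => .owedgeL (c.comp e) Δ
  | .owedgeR Δ c, e => .owedgeR Δ (c.comp e)

theorem Ctx.fill_comp (c e : Ctx α) (Δ : Struct α) : (c.comp e).fill Δ = c.fill (e.fill Δ) := by
  induction c <;> simp only [Ctx.fill, Ctx.comp, *]

/-- The concept lattice of the relation between structures `Δ` and pairs of a context `Γ[-]` and a
formula `C` which says that `Γ[Δ] ⇒ C` has a cut-free derivation. The extents of its elements are
the closed sets of structures. -/
abbrev CutFreeAlgebra (α : Type*) : Type _ :=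
  Concept (Struct α) (Ctx α × Formula α) fun Δ p => CutFreeDerivable (p.1.fill Δ) p.2

namespace CutFreeAlgebra

open Concept

variable {X Y Z : CutFreeAlgebra α} {Γ Δ : Struct α}

theorem mem_extent_of_forall_fill (hΓ : Γ ∈ X.extent)
    (h : ∀ (c : Ctx α) (C : Formula α),
      CutFreeDerivable (c.fill Γ) C → CutFreeDerivable (c.fill Δ) C) : Δ ∈ X.extent := by
  rw [← X.lowerPolar_intent]
  exact fun _ hp => h _ _ (X.rel_extent_intent hΓ hp)

theorem odot_mem_extent_left (hΓ : Γ ∈ X.extent) : .odot Γ Δ ∈ X.extent :=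
  mem_extent_of_forall_fill hΓ fun c C ⟨d, hd⟩ => ⟨.odotW₂ c Γ Δ C d, hd⟩

theorem odot_mem_extent_right (hΔ : Δ ∈ X.extent) : .odot Γ Δ ∈ X.extent :=
  mem_extent_of_forall_fill hΔ fun c C ⟨d, hd⟩ => ⟨.odotW₁ c Γ Δ C d, hd⟩

theorem owedge_mem_extent_inf (hΓ : Γ ∈ X.extent) (hΔ : Δ ∈ Y.extent) :
    .owedge Γ Δ ∈ (X ⊓ Y).extent :=
  ⟨mem_extent_of_forall_fill hΓ fun c C ⟨d, hd⟩ => ⟨.owedgeW₂ c Γ Δ C d, hd⟩,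
    mem_extent_of_forall_fill hΔ fun c C ⟨d, hd⟩ => ⟨.owedgeW₁ c Γ Δ C d, hd⟩⟩

theorem inf_le_iff_forall_owedge_mem :
    X ⊓ Y ≤ Z ↔ ∀ Γ ∈ X.extent, ∀ Δ ∈ Y.extent, .owedge Γ Δ ∈ Z.extent :=
  ⟨fun h _ hΓ _ hΔ => h (owedge_mem_extent_inf hΓ hΔ), fun h Γ hΓ =>
    mem_extent_of_forall_fill (h Γ hΓ.1 Γ hΓ.2) fun c C ⟨d, hd⟩ => ⟨.owedgeC c Γ C d, hd⟩⟩

instance : Mul (CutFreeAlgebra α) where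
  mul X Y := ofObjects _ (Set.image2 .odot X.extent Y.extent)

theorem mul_le_iff_forall_odot_mem :
    X * Y ≤ Z ↔ ∀ Γ ∈ X.extent, ∀ Δ ∈ Y.extent, .odot Γ Δ ∈ Z.extent :=
  ofObjects_le_iff.trans Set.image2_subset_iff

theorem odot_mem_extent_mul (hΓ : Γ ∈ X.extent) (hΔ : Δ ∈ Y.extent) :
    .odot Γ Δ ∈ (X * Y).extent :=
  mul_le_iff_forall_odot_mem.1 le_rfl Γ hΓ Δ hΔ

/-- The concept whose extent is the set of the structures `Γ` with `e[Γ]` in the extent of `Z`. -/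
def comap (e : Ctx α) (Z : CutFreeAlgebra α) : CutFreeAlgebra α :=
  ofAttributes _ ((fun p => (p.1.comp e, p.2)) '' Z.intent)

theorem mem_extent_comap {e : Ctx α} : Γ ∈ (comap e Z).extent ↔ e.fill Γ ∈ Z.extent := by
  rw [← Z.lowerPolar_intent]
  simp only [comap, extent_ofAttributes, mem_lowerPolar_iff, Set.forall_mem_image, Ctx.fill_comp]

/-- The concept whose extent is the set of the structures `Γ` with `e Δ [Γ]` in the extent of `Z`
for all `Δ` in the extent of `X`. It gives the residuals of the product, and that of the meet. -/
def residual (e : Struct α → Ctx α) (X Z : CutFreeAlgebra α) : CutFreeAlgebra α :=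
  ⨅ Δ ∈ X.extent, comap (e Δ) Z

theorem mem_extent_residual {e : Struct α → Ctx α} :
    Γ ∈ (residual e X Z).extent ↔ ∀ Δ ∈ X.extent, (e Δ).fill Γ ∈ Z.extent := by
  simp only [residual, extent_iInf, Set.mem_iInter, mem_extent_comap]

theorem le_residual_iff (e : Struct α → Ctx α) :
    Y ≤ residual e X Z ↔ ∀ Δ ∈ X.extent, ∀ Γ ∈ Y.extent, (e Δ).fill Γ ∈ Z.extent := by
  simp only [← extent_subset_extent_iff, Set.subset_def, mem_extent_residual]
  exact forall₂_comm

theorem inf_sup_le (X Y Z : CutFreeAlgebra α) : X ⊓ (Y ⊔ Z) ≤ X ⊓ Y ⊔ X ⊓ Z := by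
  have inf_le_iff (W : CutFreeAlgebra α) :
      X ⊓ W ≤ X ⊓ Y ⊔ X ⊓ Z ↔ W ≤ residual (.owedgeR · .hole) X (X ⊓ Y ⊔ X ⊓ Z) :=
    inf_le_iff_forall_owedge_mem.trans (le_residual_iff (.owedgeR · .hole)).symm
  rw [inf_le_iff]
  exact sup_le ((inf_le_iff Y).1 le_sup_left) ((inf_le_iff Z).1 le_sup_right)

instance : ResiduatedBasicAlgebra (CutFreeAlgebra α) where
  __ := DistribLattice.ofInfSupLe inf_sup_le
  __ := (inferInstance : BoundedOrder (CutFreeAlgebra α))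
  rres X Z := residual (.odotR · .hole) X Z
  lres Z Y := residual (.odotL .hole ·) Y Z
  mul_le_iff_le_rres _ _ _ :=
    mul_le_iff_forall_odot_mem.trans (le_residual_iff (.odotR · .hole)).symm
  mul_le_iff_le_lres _ _ _ :=
    (mul_le_iff_forall_odot_mem.trans forall₂_comm).trans (le_residual_iff (.odotL .hole ·)).symm
  mul_le_left _ _ := mul_le_iff_forall_odot_mem.2 fun _ hΓ _ _ => odot_mem_extent_left hΓ
  mul_le_right _ _ := mul_le_iff_forall_odot_mem.2 fun _ _ _ hΔ => odot_mem_extent_right hΔ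
  mul_le_mul_mul_self _ _ := mul_le_iff_forall_odot_mem.2 fun Γ hΓ Δ hΔ =>
    mem_extent_of_forall_fill (odot_mem_extent_mul (odot_mem_extent_mul hΓ hΔ) hΔ)
      fun c C ⟨d, hd⟩ => ⟨.odotC c Γ Δ C d, hd⟩

/-- The concept whose extent is the set of the structures that derive `A` without cut. -/
def derives (A : Formula α) : CutFreeAlgebra α :=
  ofAttribute _ (.hole, A)

theorem mem_extent_derives {A : Formula α} : Γ ∈ (derives A).extent ↔ CutFreeDerivable Γ A :=
  mem_lowerPolar_singleton _

theorem fm_or_mem_extent_sup {A B : Formula α} (hA : .fm A ∈ X.extent) (hB : .fm B ∈ Y.extent) :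
    .fm (.or A B) ∈ (X ⊔ Y).extent := by
  rw [extent_sup]
  rintro ⟨c, C⟩ ⟨hX, hY⟩
  obtain ⟨d, hd⟩ := rel_extent_intent hA hX
  obtain ⟨e, he⟩ := rel_extent_intent hB hY
  exact ⟨.orL c A B C d e, hd, he⟩

/-- The valuation in which a letter denotes the structures that derive it without cut. -/
def valuation (p : α) : CutFreeAlgebra α :=
  derives (.var p)

end CutFreeAlgebra

open CutFreeAlgebra

theorem Formula.fm_mem_extent_interp_and_interp_le_derives (A : Formula α) :
    .fm A ∈ (A.interp valuation).extent ∧ A.interp valuation ≤ derives A := by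
  induction A with
  | var p => exact ⟨mem_extent_derives.2 ⟨.id _, trivial⟩, le_rfl⟩
  | bot => exact ⟨fun p _ => CutFreeDerivable.bot_left p.1 p.2, bot_le⟩
  | top => exact ⟨trivial, fun Γ _ => mem_extent_derives.2 (.top_right Γ)⟩
  | and A B hA hB =>
    refine ⟨mem_extent_of_forall_fill (owedge_mem_extent_inf hA.1 hB.1)
      fun c C ⟨d, hd⟩ => ⟨.andL c A B C d, hd⟩, fun Γ hΓ => ?_⟩
    obtain ⟨d, hd⟩ := mem_extent_derives.1 (hA.2 hΓ.1)
    obtain ⟨e, he⟩ := mem_extent_derives.1 (hB.2 hΓ.2)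
    exact mem_extent_derives.2 ⟨.andR Γ A B d e, hd, he⟩
  | or A B hA hB =>
    refine ⟨fm_or_mem_extent_sup hA.1 hB.1, sup_le (fun Γ hΓ => ?_) (fun Γ hΓ => ?_)⟩
    · obtain ⟨d, hd⟩ := mem_extent_derives.1 (hA.2 hΓ)
      exact mem_extent_derives.2 ⟨.orR₁ Γ A B d, hd⟩
    · obtain ⟨d, hd⟩ := mem_extent_derives.1 (hB.2 hΓ)
      exact mem_extent_derives.2 ⟨.orR₂ Γ A B d, hd⟩
  | prod A B hA hB =>
    refine ⟨mem_extent_of_forall_fill (odot_mem_extent_mul hA.1 hB.1)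
      fun c C ⟨d, hd⟩ => ⟨.prodL c A B C d, hd⟩,
      mul_le_iff_forall_odot_mem.2 fun Γ hΓ Δ hΔ => ?_⟩
    obtain ⟨d, hd⟩ := mem_extent_derives.1 (hA.2 hΓ)
    obtain ⟨e, he⟩ := mem_extent_derives.1 (hB.2 hΔ)
    exact mem_extent_derives.2 ⟨.prodR Γ Δ A B d e, hd, he⟩
  | imp A B hA hB =>
    refine ⟨mem_extent_residual.2 fun Δ hΔ => ?_, fun Γ hΓ => ?_⟩
    · obtain ⟨d, hd⟩ := mem_extent_derives.1 (hA.2 hΔ)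
      exact mem_extent_of_forall_fill hB.1 fun c C ⟨e, he⟩ => ⟨.impL c Δ A B C d e, hd, he⟩
    · obtain ⟨d, hd⟩ := mem_extent_derives.1 (hB.2 (mem_extent_residual.1 hΓ _ hA.1))
      exact mem_extent_derives.2 ⟨.impR Γ A B d, hd⟩
  | limp A B hA hB =>
    refine ⟨mem_extent_residual.2 fun Δ hΔ => ?_, fun Γ hΓ => ?_⟩
    · obtain ⟨d, hd⟩ := mem_extent_derives.1 (hB.2 hΔ)
      exact mem_extent_of_forall_fill hA.1 fun c C ⟨e, he⟩ => ⟨.limpL c Δ A B C e d, he, hd⟩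
    · obtain ⟨d, hd⟩ := mem_extent_derives.1 (hA.2 (mem_extent_residual.1 hΓ _ hB.1))
      exact mem_extent_derives.2 ⟨.limpR Γ A B d, hd⟩

theorem Struct.mem_extent_interp (Γ : Struct α) : Γ ∈ (Γ.interp valuation).extent := by
  induction Γ with
  | fm A => exact A.fm_mem_extent_interp_and_interp_le_derives.1
  | odot Γ Δ hΓ hΔ => exact odot_mem_extent_mul hΓ hΔ
  | owedge Γ Δ hΓ hΔ => exact owedge_mem_extent_inf hΓ hΔ

theorem Derivable.cutFreeDerivable {Γ : Struct α} {A : Formula α} (h : Derivable Γ A) :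
    CutFreeDerivable Γ A := by
  obtain ⟨d⟩ := h
  have hΓ : Γ ∈ (A.interp valuation).extent := d.interp_le valuation Γ.mem_extent_interp
  exact mem_extent_derives.1 (A.fm_mem_extent_interp_and_interp_le_derives.2 hΓ)

section Subformulas

/-- Sets of formulae that contain the subformulae of their elements. -/
def IsSubformulaClosed (S : Set (Formula α)) : Prop :=
  ∀ A ∈ S, A.subformulas ⊆ S

theorem Formula.mem_subformulas_self (A : Formula α) : A ∈ A.subformulas := by
  cases A <;> simp [Formula.subformulas]

theorem Formula.isSubformulaClosed_subformulas (A : Formula α) :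
    IsSubformulaClosed A.subformulas := by
  intro B hB
  induction A with
  | var | bot | top => rw [hB]
  | and C D hC hD | or C D hC hD | prod C D hC hD | imp C D hC hD | limp C D hC hD =>
    obtain (rfl | hB) | hB := hB
    · exact subset_rfl
    · exact (hC hB).trans (Set.subset_union_right.trans Set.subset_union_left)
    · exact (hD hB).trans Set.subset_union_right

/-- The subformulae of the formulae occurring in a sequent. -/
def Sequent.subformulas (s : Sequent α) : Set (Formula α) :=
  ⋃ A ∈ s.formulas, A.subformulas

theorem Sequent.isSubformulaClosed_subformulas (s : Sequent α) :
    IsSubformulaClosed s.subformulas := by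
  intro A hA
  obtain ⟨B, hB, hAB⟩ := Set.mem_iUnion₂.1 hA
  exact (B.isSubformulaClosed_subformulas A hAB).trans (Set.subset_biUnion_of_mem hB)

theorem Sequent.formulas_subset_subformulas (s : Sequent α) : s.formulas ⊆ s.subformulas :=
  fun A hA => Set.mem_biUnion hA A.mem_subformulas_self

/-- The formulae that a context is built from. -/
def Ctx.formulas : Ctx α → Set (Formula α)
  | .hole => ∅
  | .odotL c Δ | .odotR Δ c | .owedgeL c Δ | .owedgeR Δ c => c.formulas ∪ Δ.formulas

theorem Ctx.formulas_fill (c : Ctx α) (Δ : Struct α) :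
    (c.fill Δ).formulas = c.formulas ∪ Δ.formulas := by
  induction c with
  | hole => exact (Set.empty_union _).symm
  | odotL c Θ ih | owedgeL c Θ ih =>
    simp only [Ctx.fill, Struct.formulas, Ctx.formulas, ih, Set.union_right_comm]
  | odotR Θ c ih | owedgeR Θ c ih =>
    simp only [Ctx.fill, Struct.formulas, Ctx.formulas, ih, Set.union_comm Θ.formulas,
      Set.union_right_comm]

theorem IsSubformulaClosed.components_mem {S : Set (Formula α)} (hS : IsSubformulaClosed S)
    {A B C : Formula α} (h : C ∈ S)
    (hC : C.subformulas = {C} ∪ A.subformulas ∪ B.subformulas) : A ∈ S ∧ B ∈ S :=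
  ⟨hS C h (hC ▸ .inl (.inr A.mem_subformulas_self)), hS C h (hC ▸ .inr B.mem_subformulas_self)⟩

theorem Derivation.IsCutFree.formulas_subset {S : Set (Formula α)} (hS : IsSubformulaClosed S)
    {Γ : Struct α} {A : Formula α} {d : Derivation Γ A} (hd : d.IsCutFree)
    (h : (Sequent.mk Γ A).formulas ⊆ S) : d.formulas ⊆ S := by
  induction d <;> simp only [Derivation.formulas, IsCutFree, Sequent.formulas, Ctx.formulas_fill,
    Struct.formulas, Set.union_subset_iff, Set.singleton_subset_iff, Set.empty_subset] at *
  case impL => have components_mem := hS.components_mem h.1.2.2 rfl; simp_all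
  case limpL => have components_mem := hS.components_mem h.1.2.1 rfl; simp_all
  case prodL | andL | orL => have components_mem := hS.components_mem h.1.2 rfl; simp_all
  case impR | limpR | prodR | andR | orR₁ | orR₂ =>
    have components_mem := hS.components_mem h.2 rfl; simp_all
  all_goals simp_all

end Subformulas

end RBL

theorem mainTheorem5_general {α : Type*} (Γ : RBL.Struct α) (A : RBL.Formula α)
    (h : RBL.Derivable Γ A) :
    ∃ d : RBL.Derivation Γ A, d.IsCutFree ∧ ∀ B ∈ d.formulas,
      (∃ C ∈ Γ.formulas, B ∈ C.subformulas) ∨ B ∈ A.subformulas := by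
  obtain ⟨d, hd⟩ := h.cutFreeDerivable
  refine ⟨d, hd, fun B hB => ?_⟩
  let s : RBL.Sequent α := ⟨Γ, A⟩
  obtain ⟨C, hC | rfl, hBC⟩ := Set.mem_iUnion₂.1
    (hd.formulas_subset s.isSubformulaClosed_subformulas s.formulas_subset_subformulas hB)
  · exact .inl ⟨C, hC, hBC⟩
  · exact .inr hBC

theorem mainTheorem5 {α : Type*} (Γ : RBL.Struct α) (A : RBL.Formula α)
    (h : RBL.Derivable Γ A) :
    ∃ d : RBL.Derivation Γ A, ∀ B ∈ d.formulas,
      B = RBL.Formula.top ∨ B = RBL.Formula.bot ∨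
        (∃ C ∈ Γ.formulas, B ∈ C.subformulas) ∨ B ∈ A.subformulas := by
  obtain ⟨d, -, hd⟩ := mainTheorem5_general Γ A h
  exact ⟨d, fun B hB => .inr (.inr (hd B hB))⟩
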